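/- Consider finite simple undirected graphs whose vertices are colored with colors from a finite set, each vertex having one color, as structures with the adjacency relation and one unary relation for each color. First-order formulas (with equality) are taken in negation normal form, and the quantifier depth of a formula is the maximum number of nested quantifiers in it. For $i\ge 1$, let $\Sigma_i\cap\mathrm{FO}^2$ be the set of formulas that use at most two (reusable) variables and in which every sequence of nested quantifiers begins with $\exists$ and has at most $i-1$ quantifier alternations. A sentence distinguishes $G$ from $H$ if it is true on $G$ and false on $H$; let $D^2_{\Sigma_i}(G,H)$ be the minimum quantifier depth of a sentence in $\Sigma_i\cap\mathrm{FO}^2$ that distinguishes $G$ from $H$ ($\infty$ if there is none). There is a finite set of colors such that the following holds for every $i\ge 1$. There are infinitely many $n$ for which there exist colored graphs $G$ and $H$ over this set of colors, both on $n$ vertices, such that $G$ is distinguishable from $H$ in $\Sigma_i\cap\mathrm{FO}^2$ and $$D^2_{\Sigma_i}(G,H)>\frac{1}{11\cdot 9^i}\,n^2-\frac{1}{11\cdot 3^i}\,n.$$ -/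

import Mathlib

namespace ColoredFO

/-- An undirected simple graph on `V` whose vertices are colored with colors from `C`. -/
structure ColoredGraph (C V : Type) where
  graph : SimpleGraph V
  color : V → C

/-- The two kinds of quantifiers. -/
inductive Quant
  | ex
  | all
  deriving DecidableEq

/-- Atomic formulas over the vocabulary of colored graphs (equality, adjacency and one unary
relation for each color in `C`), with variables from `Fin k`. -/
inductive Atom (C : Type) (k : ℕ)
  | eq (x y : Fin k)
  | adj (x y : Fin k)
  | col (a : C) (x : Fin k)

/-- First-order formulas in negation normal form over the vocabulary of colored graphs that use
only the `k` variables in `Fin k`. A variable may be quantified repeatedly. -/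
inductive Formula (C : Type) (k : ℕ)
  | atom (α : Atom C k)
  | negAtom (α : Atom C k)
  | and (φ ψ : Formula C k)
  | or (φ ψ : Formula C k)
  | quant (q : Quant) (x : Fin k) (φ : Formula C k)

variable {C V W : Type} {k : ℕ}

/-- The variables occurring in an atomic formula. -/
def Atom.vars : Atom C k → Finset (Fin k)
  | .eq x y => {x, y}
  | .adj x y => {x, y}
  | .col _ x => {x}

/-- Truth of an atomic formula in `G` under the assignment `v`. -/
def Atom.Sat (G : ColoredGraph C V) (v : Fin k → V) : Atom C k → Prop
  | .eq x y => v x = v y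
  | .adj x y => G.graph.Adj (v x) (v y)
  | .col a x => G.color (v x) = a

namespace Formula

/-- The free variables of a formula. -/
def freeVars : Formula C k → Finset (Fin k)
  | atom α => α.vars
  | negAtom α => α.vars
  | and φ ψ => φ.freeVars ∪ ψ.freeVars
  | or φ ψ => φ.freeVars ∪ ψ.freeVars
  | quant _ x φ => φ.freeVars.erase x

/-- Truth of a formula in `G` under the assignment `v`. -/
def Sat (G : ColoredGraph C V) : (Fin k → V) → Formula C k → Prop
  | v, atom α => α.Sat G v
  | v, negAtom α => ¬ α.Sat G v
  | v, and φ ψ => Sat G v φ ∧ Sat G v ψ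
  | v, or φ ψ => Sat G v φ ∨ Sat G v ψ
  | v, quant .ex x φ => ∃ a : V, Sat G (Function.update v x a) φ
  | v, quant .all x φ => ∀ a : V, Sat G (Function.update v x a) φ

/-- The quantifier depth of a formula. -/
def depth : Formula C k → ℕ
  | atom _ => 0
  | negAtom _ => 0
  | and φ ψ => max φ.depth ψ.depth
  | or φ ψ => max φ.depth ψ.depth
  | quant _ _ φ => φ.depth + 1

/-- Every sequence of nested quantifiers of the formula begins with `q`, that is, each outermost
quantifier is `q`. -/
def BeginsWith (q : Quant) : Formula C k → Prop
  | atom _ => True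
  | negAtom _ => True
  | and φ ψ => φ.BeginsWith q ∧ ψ.BeginsWith q
  | or φ ψ => φ.BeginsWith q ∧ ψ.BeginsWith q
  | quant q' _ _ => q' = q

/-- The maximum number of quantifier alternations in a sequence consisting of `q` followed by
a sequence of nested quantifiers of the formula. If the formula begins with `q`, this is the
maximum number of alternations in a sequence of its nested quantifiers. -/
def alternations : Quant → Formula C k → ℕ
  | _, atom _ => 0
  | _, negAtom _ => 0
  | q, and φ ψ => max (φ.alternations q) (ψ.alternations q)
  | q, or φ ψ => max (φ.alternations q) (ψ.alternations q)
  | q, quant q' _ φ => (if q' = q then 0 else 1) + φ.alternations q'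

/-- A formula without free variables. -/
def IsSentence (φ : Formula C k) : Prop := φ.freeVars = ∅

/-- A sentence is true on `G`. Structures have nonempty universes, so that for a sentence it is
irrelevant whether all assignments or some assignment is used. -/
def TrueOn (φ : Formula C k) (G : ColoredGraph C V) : Prop := ∀ v : Fin k → V, φ.Sat G v

/-- `φ` is a sentence that is true on `G` but false on `H`. -/
def Distinguishes (φ : Formula C k) (G : ColoredGraph C V) (H : ColoredGraph C W) : Prop :=
  φ.IsSentence ∧ φ.TrueOn G ∧ ¬ φ.TrueOn H

end Formula

/-- The fragment `Σ_i ∩ FO^k`, for `i ≥ 1`: formulas with `k` variables in which every sequence of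
nested quantifiers begins with `∃` and has at most `i - 1` (that is, fewer than `i`)
alternations. -/
def sigmaFO (C : Type) (i k : ℕ) : Set (Formula C k) :=
  {φ | φ.BeginsWith .ex ∧ φ.alternations .ex < i}

/-- `G` is distinguishable from `H` in the fragment `L`. -/
def Distinguishable (L : Set (Formula C k)) (G : ColoredGraph C V) (H : ColoredGraph C W) : Prop :=
  ∃ φ ∈ L, φ.Distinguishes G H

/-- `D_L(G, H)`: the minimum quantifier depth of a formula in `L` distinguishing `G` from `H`;
it is `∞` if there is no such formula. -/
noncomputable def minDepth (L : Set (Formula C k)) (G : ColoredGraph C V) (H : ColoredGraph C W) :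
    ℕ∞ :=
  ⨅ φ ∈ {φ : Formula C k | φ ∈ L ∧ φ.Distinguishes G H}, (φ.depth : ℕ∞)

end ColoredFO

/-! A cycle of length `3P` with one marked vertex and a cycle of length `3Q` all of whose vertices
at positions divisible by `3`, except for the position `0`, have a marked twin are hard to tell
apart when `P` and `Q` are coprime: Duplicator answers moves from the first cycle as if both cycles
were walked along in parallel, and this is betrayed only when both walks return to position `0`,
that is, after `3PQ` steps. Colors modulo `3` orient the cycles, so that a purely existential
sentence can follow the long walk.

Higher levels of the hierarchy come from ternary trees over the two cycles. A tree labelled `true`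
has exactly one child labelled `false`, while a tree labelled `false` has none, so that two trees
can be told apart only by switching to the other graph at every level. The two spare children always
leave Duplicator a component avoiding the other pebble. To use finitely many colors independently of
the height, the levels are colored modulo `3`; identifying colors can only help Duplicator, and the
neighboring levels of a tree remain distinguishable.

With `P = 4t + 1` and `Q = 3t + 1` both cycles have `12t + 3` vertices, and Duplicator survives
about `18t²` rounds.
-/

namespace ColoredFO

variable {C D V W : Type}

/-- The dual quantifier. -/
def Quant.dual : Quant → Quant
  | .ex => .all
  | .all => .ex

theorem Atom.sat_congr {k : ℕ} (G : ColoredGraph C V) (α : Atom C k) {u v : Fin k → V}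
    (h : ∀ x ∈ α.vars, u x = v x) : α.Sat G u ↔ α.Sat G v := by
  cases α <;> simp_all [Atom.vars, Atom.Sat]

namespace Formula

variable {k : ℕ}

theorem sat_congr (G : ColoredGraph C V) (φ : Formula C k) {u v : Fin k → V}
    (h : ∀ x ∈ φ.freeVars, u x = v x) : φ.Sat G u ↔ φ.Sat G v := by
  induction φ generalizing u v with
  | atom α => exact α.sat_congr G h
  | negAtom α => exact not_congr (α.sat_congr G h)
  | and φ ψ ihφ ihψ =>
    exact and_congr (ihφ fun x hx => h x (Finset.mem_union_left _ hx))
      (ihψ fun x hx => h x (Finset.mem_union_right _ hx))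
  | or φ ψ ihφ ihψ =>
    exact or_congr (ihφ fun x hx => h x (Finset.mem_union_left _ hx))
      (ihψ fun x hx => h x (Finset.mem_union_right _ hx))
  | quant q x φ ih =>
    have agree (a : V) : ∀ y ∈ φ.freeVars, Function.update u x a y = Function.update v x a y := by
      intro y hy
      obtain rfl | hyx := eq_or_ne y x
      · simp only [Function.update_self]
      · simp only [Function.update_of_ne hyx, h y (Finset.mem_erase.2 ⟨hyx, hy⟩)]
    cases q
    · exact exists_congr fun a => ih (agree a)
    · exact forall_congr' fun a => ih (agree a)

theorem IsSentence.sat_iff {φ : Formula C k} (hφ : φ.IsSentence) (G : ColoredGraph C V)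
    (u v : Fin k → V) : φ.Sat G u ↔ φ.Sat G v :=
  φ.sat_congr G fun x hx => absurd hx (by simp [show φ.freeVars = ∅ from hφ])

/-- The negation of a formula, in negation normal form. -/
def neg : Formula C k → Formula C k
  | atom α => negAtom α
  | negAtom α => atom α
  | and φ ψ => or φ.neg ψ.neg
  | or φ ψ => and φ.neg ψ.neg
  | quant q x φ => quant q.dual x φ.neg

theorem sat_neg (G : ColoredGraph C V) (φ : Formula C k) (v : Fin k → V) :
    φ.neg.Sat G v ↔ ¬ φ.Sat G v := by
  induction φ generalizing v with
  | atom α => exact Iff.rfl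
  | negAtom α => exact not_not.symm
  | and φ ψ ihφ ihψ => simp only [neg, Sat, ihφ, ihψ, not_and_or]
  | or φ ψ ihφ ihψ => simp only [neg, Sat, ihφ, ihψ, not_or]
  | quant q x φ ih => cases q <;> simp [neg, Sat, Quant.dual, ih]

theorem freeVars_neg (φ : Formula C k) : φ.neg.freeVars = φ.freeVars := by
  induction φ <;> simp_all [neg, freeVars]

theorem alternations_neg (φ : Formula C k) (q : Quant) :
    φ.neg.alternations q = φ.alternations q.dual := by
  induction φ generalizing q with
  | atom α => rfl
  | negAtom α => rfl
  | and φ ψ ihφ ihψ => simp only [neg, alternations, ihφ, ihψ]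
  | or φ ψ ihφ ihψ => simp only [neg, alternations, ihφ, ihψ]
  | quant q' x φ ih => cases q <;> cases q' <;> simp [neg, alternations, Quant.dual, ih]

end Formula

/-- The pullback of a colored graph along a bijection of the vertices. -/
def ColoredGraph.comap (e : W ≃ V) (G : ColoredGraph C V) : ColoredGraph C W where
  graph := G.graph.comap e
  color := G.color ∘ e

/-- The recoloring of a colored graph along a map of the colors. -/
def ColoredGraph.map (ρ : C → D) (G : ColoredGraph C V) : ColoredGraph D V where
  graph := G.graph
  color := ρ ∘ G.color

namespace Formula

variable {k : ℕ}

theorem sat_comap (e : W ≃ V) (G : ColoredGraph C V) (φ : Formula C k) (v : Fin k → W) :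
    φ.Sat (G.comap e) v ↔ φ.Sat G (e ∘ v) := by
  have sat_atom (α : Atom C k) (v : Fin k → W) : α.Sat (G.comap e) v ↔ α.Sat G (e ∘ v) := by
    cases α <;> simp [Atom.Sat, ColoredGraph.comap]
  induction φ generalizing v with
  | atom α => exact sat_atom α v
  | negAtom α => exact not_congr (sat_atom α v)
  | and φ ψ ihφ ihψ => exact and_congr (ihφ v) (ihψ v)
  | or φ ψ ihφ ihψ => exact or_congr (ihφ v) (ihψ v)
  | quant q x φ ih =>
    cases q
    · simp only [Sat, ih, Function.comp_update]
      exact (e.surjective.exists (p := fun a => φ.Sat G (Function.update (e ∘ v) x a))).symm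
    · simp only [Sat, ih, Function.comp_update]
      exact (e.surjective.forall (p := fun a => φ.Sat G (Function.update (e ∘ v) x a))).symm

theorem trueOn_comap (e : W ≃ V) (G : ColoredGraph C V) (φ : Formula C k) :
    φ.TrueOn (G.comap e) ↔ φ.TrueOn G := by
  simp only [TrueOn, sat_comap]
  exact ((e.surjective.comp_left (α := Fin k)).forall (p := fun v => φ.Sat G v)).symm

theorem distinguishes_comap {V' W' : Type} (e : W ≃ V) (e' : W' ≃ V') (G : ColoredGraph C V)
    (H : ColoredGraph C V') (φ : Formula C k) :
    φ.Distinguishes (G.comap e) (H.comap e') ↔ φ.Distinguishes G H := by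
  simp only [Distinguishes, trueOn_comap]

end Formula

theorem Distinguishable.exists_depth_eq_minDepth {k : ℕ} {L : Set (Formula C k)}
    {G : ColoredGraph C V} {H : ColoredGraph C W} (h : Distinguishable L G H) :
    ∃ φ ∈ L, φ.Distinguishes G H ∧ minDepth L G H = (φ.depth : ℕ∞) := by
  obtain ⟨φ, hφL, hφ⟩ := h
  obtain ⟨ψ, ⟨hψL, hψ⟩, hmin⟩ := csInf_mem (s := (fun φ : Formula C k => (φ.depth : ℕ∞)) ''
    {φ | φ ∈ L ∧ φ.Distinguishes G H}) ⟨_, φ, ⟨hφL, hφ⟩, rfl⟩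
  exact ⟨ψ, hψL, hψ, by rw [minDepth, ← sInf_image, ← hmin]⟩

section Game

/-- The pairs `(x, x')` and `(y, y')` have the same equality and adjacency type. -/
def SamePairType (G : ColoredGraph C V) (H : ColoredGraph C W) (x x' : V) (y y' : W) : Prop :=
  (x = x' ↔ y = y') ∧ (G.graph.Adj x x' ↔ H.graph.Adj y y')

/-- `DuplicatorWins m r G H x y`: Duplicator wins the two-pebble game with `r` moves in which
Spoiler starts in `G` and switches at most `m` times between the graphs, from the position with
one pair of pebbles on `x` and `y`. A move forgets the pebbles other than the last pair, and so
the state of a game with two pairs of pebbles is a single pair. -/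
def DuplicatorWins : ℕ → ℕ → {V W : Type} →
    ColoredGraph C V → ColoredGraph C W → V → W → Prop
  | _, 0, _, _, G, H, x, y => G.color x = H.color y
  | m, r + 1, _, _, G, H, x, y => G.color x = H.color y ∧
    (∀ x', ∃ y', SamePairType G H x x' y y' ∧ DuplicatorWins m r G H x' y') ∧
    ∀ m', m = m' + 1 → ∀ y', ∃ x', SamePairType H G y y' x x' ∧ DuplicatorWins m' r H G y' x'

variable {G : ColoredGraph C V} {H : ColoredGraph C W} {m m' r r' : ℕ} {x x' : V} {y y' : W}

theorem SamePairType.symm (h : SamePairType G H x x' y y') : SamePairType H G y y' x x' :=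
  ⟨h.1.symm, h.2.symm⟩

theorem SamePairType.swap (h : SamePairType G H x x' y y') : SamePairType G H x' x y' y :=
  ⟨by rw [eq_comm, h.1, eq_comm], by rw [G.graph.adj_comm, h.2, H.graph.adj_comm]⟩

theorem samePairType_self : SamePairType G H x x y y :=
  ⟨by simp only, by simp only [SimpleGraph.irrefl]⟩

namespace DuplicatorWins

theorem color_eq (h : DuplicatorWins m r G H x y) : G.color x = H.color y := by
  cases r with
  | zero => exact h
  | succ r => exact h.1

theorem mono (hm : m' ≤ m) (hr : r' ≤ r) (h : DuplicatorWins m r G H x y) :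
    DuplicatorWins m' r' G H x y := by
  induction r' generalizing V W m m' r with
  | zero => exact h.color_eq
  | succ r' ih =>
    obtain ⟨r, rfl⟩ : ∃ s, r = s + 1 := Nat.exists_eq_add_of_le' (Nat.le_of_add_left_le hr)
    have hr' : r' ≤ r := Nat.le_of_succ_le_succ hr
    refine ⟨h.color_eq, fun x' => ?_, ?_⟩
    · obtain ⟨y', hpair, hwin⟩ := h.2.1 x'
      exact ⟨y', hpair, ih hm hr' hwin⟩
    · rintro k rfl y'
      obtain ⟨m, rfl⟩ : ∃ l, m = l + 1 := Nat.exists_eq_add_of_le' (Nat.le_of_add_left_le hm)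
      obtain ⟨x', hpair, hwin⟩ := h.2.2 m rfl y'
      exact ⟨x', hpair, ih (Nat.le_of_succ_le_succ hm) hr' hwin⟩

theorem forth (h : DuplicatorWins m (r + 1) G H x y) (x' : V) :
    ∃ y', SamePairType G H x x' y y' ∧ DuplicatorWins m r G H x' y' :=
  h.2.1 x'

theorem swap (h : DuplicatorWins (m + 1) r G H x y) : DuplicatorWins m r H G y x := by
  cases r with
  | zero => exact h.symm
  | succ r =>
    refine ⟨h.color_eq.symm, h.2.2 m rfl, ?_⟩
    rintro m rfl x'
    obtain ⟨y', hpair, hwin⟩ := h.forth x'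
    exact ⟨y', hpair, hwin.mono (by omega) le_rfl⟩

theorem refl (G : ColoredGraph C V) (m r : ℕ) (x : V) : DuplicatorWins m r G G x x := by
  induction r generalizing m x with
  | zero => exact rfl
  | succ r ih =>
    exact ⟨rfl, fun x' => ⟨x', ⟨Iff.rfl, Iff.rfl⟩, ih m x'⟩,
      fun m' _ x' => ⟨x', ⟨Iff.rfl, Iff.rfl⟩, ih m' x'⟩⟩

theorem map (ρ : C → D) (h : DuplicatorWins m r G H x y) :
    DuplicatorWins m r (G.map ρ) (H.map ρ) x y := by
  induction r generalizing V W m with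
  | zero => exact congrArg ρ h
  | succ r ih =>
    refine ⟨congrArg ρ h.color_eq, fun x' => ?_, fun m' hm y' => ?_⟩
    · obtain ⟨y', hpair, hwin⟩ := h.forth x'
      exact ⟨y', hpair, ih hwin⟩
    · obtain ⟨x', hpair, hwin⟩ := h.2.2 m' hm y'
      exact ⟨x', hpair, ih hwin⟩

end DuplicatorWins

/-- The assignments `u` and `v` form a position of the two-pebble game that is winning for
Duplicator. -/
structure WinningPosition (m r : ℕ) (G : ColoredGraph C V) (H : ColoredGraph C W)
    (u : Fin 2 → V) (v : Fin 2 → W) : Prop where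
  wins (k : Fin 2) : DuplicatorWins m r G H (u k) (v k)
  samePairType (k l : Fin 2) : SamePairType G H (u k) (u l) (v k) (v l)

namespace WinningPosition

variable {u : Fin 2 → V} {v : Fin 2 → W}

theorem swap (h : WinningPosition (m + 1) r G H u v) : WinningPosition m r H G v u :=
  ⟨fun k => (h.wins k).swap, fun k l => (h.samePairType k l).symm⟩

theorem forth (h : WinningPosition m (r + 1) G H u v) (k : Fin 2) (x : V) :
    ∃ y, WinningPosition m r G H (Function.update u k x) (Function.update v k y) := by
  obtain ⟨y, hpair, hwin⟩ := (h.wins (1 - k)).forth x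
  have hfixed : DuplicatorWins m r G H (u (1 - k)) (v (1 - k)) :=
    (h.wins _).mono le_rfl (Nat.le_succ r)
  have hpair' := hpair.swap
  refine ⟨y, ⟨?_, ?_⟩⟩ <;> fin_cases k <;> simp_all [Fin.forall_fin_two, samePairType_self]

theorem back (h : WinningPosition (m + 1) (r + 1) G H u v) (k : Fin 2) (y : W) :
    ∃ x, WinningPosition m r H G (Function.update v k y) (Function.update u k x) :=
  h.swap.forth k y

theorem sat_atom_iff (h : WinningPosition m r G H u v) (α : Atom C 2) :
    α.Sat G u ↔ α.Sat H v := by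
  cases α with
  | eq k l => exact (h.samePairType k l).1
  | adj k l => exact (h.samePairType k l).2
  | col a k => exact iff_of_eq (congrArg (· = a) (h.wins k).color_eq)

theorem sat_transfer (h : WinningPosition m r G H u v) {φ : Formula C 2} (hφ : φ.depth ≤ r) :
    (φ.alternations .ex ≤ m → φ.Sat G u → φ.Sat H v) ∧
      (φ.alternations .all ≤ m → φ.Sat H v → φ.Sat G u) := by
  induction φ generalizing V W m r with
  | atom α => exact ⟨fun _ => (h.sat_atom_iff α).1, fun _ => (h.sat_atom_iff α).2⟩
  | negAtom α => exact ⟨fun _ => mt (h.sat_atom_iff α).2, fun _ => mt (h.sat_atom_iff α).1⟩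
  | and φ ψ ihφ ihψ =>
    simp only [Formula.depth, Formula.alternations, max_le_iff] at hφ ⊢
    exact ⟨fun hm => And.imp ((ihφ h hφ.1).1 hm.1) ((ihψ h hφ.2).1 hm.2),
      fun hm => And.imp ((ihφ h hφ.1).2 hm.1) ((ihψ h hφ.2).2 hm.2)⟩
  | or φ ψ ihφ ihψ =>
    simp only [Formula.depth, Formula.alternations, max_le_iff] at hφ ⊢
    exact ⟨fun hm => Or.imp ((ihφ h hφ.1).1 hm.1) ((ihψ h hφ.2).1 hm.2),
      fun hm => Or.imp ((ihφ h hφ.1).2 hm.1) ((ihψ h hφ.2).2 hm.2)⟩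
  | quant q k φ ih =>
    obtain ⟨r, rfl⟩ : ∃ r', r = r' + 1 := Nat.exists_eq_add_of_le' (Nat.le_of_add_left_le hφ)
    have hφr : φ.depth ≤ r := Nat.le_of_succ_le_succ hφ
    cases q
    · constructor
      · rintro hm ⟨x, hx⟩
        obtain ⟨y, hpos⟩ := h.forth k x
        exact ⟨y, (ih hpos hφr).1 (by simpa [Formula.alternations] using hm) hx⟩
      · rintro hm ⟨y, hy⟩
        simp only [Formula.alternations, reduceCtorEq, if_false] at hm
        obtain ⟨m, rfl⟩ : ∃ m', m = m' + 1 := Nat.exists_eq_add_of_le' (Nat.le_of_add_right_le hm)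
        obtain ⟨x, hpos⟩ := h.back k y
        exact ⟨x, (ih hpos hφr).1 (by omega) hy⟩
    · constructor
      · intro hm hall y
        simp only [Formula.alternations, reduceCtorEq, if_false] at hm
        obtain ⟨m, rfl⟩ : ∃ m', m = m' + 1 := Nat.exists_eq_add_of_le' (Nat.le_of_add_right_le hm)
        obtain ⟨x, hpos⟩ := h.back k y
        exact (ih hpos hφr).2 (by omega) (hall x)
      · intro hm hall x
        obtain ⟨y, hpos⟩ := h.forth k x
        exact (ih hpos hφr).2 (by simpa [Formula.alternations] using hm) (hall y)

end WinningPosition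

theorem DuplicatorWins.lt_depth (h : DuplicatorWins m r G H x y) {φ : Formula C 2}
    (hφ : φ ∈ sigmaFO C (m + 1) 2) (hd : φ.Distinguishes G H) : r < φ.depth := by
  obtain ⟨hsent, hG, hH⟩ := hd
  by_contra! hr
  refine hH fun v => (hsent.sat_iff H (fun _ => y) v).1 ?_
  have hpos : WinningPosition m r G H (fun _ => x) (fun _ => y) :=
    ⟨fun _ => h, fun _ _ => samePairType_self⟩
  exact (hpos.sat_transfer hr).1 (Nat.le_of_lt_succ hφ.2) (hG _)

end Game

section RootedUnion

/-- The disjoint union of colored graphs together with a root `none` of color `κ`, which is joined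
to the vertices of color `a`. -/
def rootedUnion {ι : Type} (κ a : C) (G : ι → ColoredGraph C V) :
    ColoredGraph C (Option (ι × V)) where
  graph :=
    { Adj := fun
        | none, none => False
        | none, some (c, x) => (G c).color x = a
        | some (c, x), none => (G c).color x = a
        | some (c, x), some (d, y) => c = d ∧ (G c).graph.Adj x y
      symm := ⟨by
        rintro (_ | ⟨c, x⟩) (_ | ⟨d, y⟩) h
        · exact h
        · exact h
        · exact h
        · obtain ⟨rfl, h⟩ := h
          exact ⟨rfl, h.symm⟩⟩
      loopless := ⟨by
        rintro (_ | ⟨c, x⟩) h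
        · exact h
        · exact h.2.ne rfl⟩ }
  color := fun
    | none => κ
    | some (c, x) => (G c).color x

/-- Duplicator can answer every first move in `G`. -/
def Covers (m r : ℕ) (G : ColoredGraph C V) (H : ColoredGraph C W) : Prop :=
  ∀ x, ∃ y, DuplicatorWins m r G H x y

/-- Duplicator can answer every first move in a component of one of the disjoint unions of `G` and
of `H` inside a component of the other one, and can avoid any one given component in doing so. -/
def Matchable {ι : Type} (m r : ℕ) (G : ι → ColoredGraph C V) (H : ι → ColoredGraph C W) : Prop :=
  (∀ c d, ∃ d' ≠ d, Covers m r (G c) (H d')) ∧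
    ∀ m', m = m' + 1 → ∀ d c, ∃ c' ≠ c, Covers m' r (H d) (G c')

/-- A sufficient condition for Duplicator to win from a position in two rooted unions: the pebbles
are on both roots, or in components on which Duplicator wins the game. -/
def Linked {ι : Type} (m r : ℕ) (G : ι → ColoredGraph C V) (H : ι → ColoredGraph C W) :
    Option (ι × V) → Option (ι × W) → Prop
  | none, none => Matchable m r G H
  | some (c, x), some (d, y) => Matchable m r G H ∧ DuplicatorWins m r (G c) (H d) x y
  | _, _ => False

variable {ι : Type} {κ a : C} {m m' r r' : ℕ}

theorem Covers.mono {G : ColoredGraph C V} {H : ColoredGraph C W} (hm : m' ≤ m) (hr : r' ≤ r)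
    (h : Covers m r G H) : Covers m' r' G H := fun x =>
  (h x).imp fun _ hy => hy.mono hm hr

theorem Covers.map {G : ColoredGraph C V} {H : ColoredGraph C W} (ρ : C → D)
    (h : Covers m r G H) : Covers m r (G.map ρ) (H.map ρ) := fun x =>
  (h x).imp fun _ hy => hy.map ρ

theorem Covers.refl (m r : ℕ) (G : ColoredGraph C V) : Covers m r G G := fun x =>
  ⟨x, .refl G m r x⟩

variable {G : ι → ColoredGraph C V} {H : ι → ColoredGraph C W}
  {p p' : Option (ι × V)} {q q' : Option (ι × W)}

theorem Matchable.mono (hr : r' ≤ r) (h : Matchable m r G H) : Matchable m r' G H :=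
  ⟨fun c d => (h.1 c d).imp fun _ hd => hd.imp_right (.mono le_rfl hr),
    fun m' hm d c => (h.2 m' hm d c).imp fun _ hc => hc.imp_right (.mono le_rfl hr)⟩

theorem Matchable.swap (h : Matchable (m + 1) r G H) : Matchable m r H G := by
  refine ⟨h.2 m rfl, ?_⟩
  rintro m' rfl c d
  exact (h.1 c d).imp fun _ hd => hd.imp_right (.mono (by omega) le_rfl)

namespace Linked

theorem matchable (h : Linked m r G H p q) : Matchable m r G H := by
  rcases p with _ | ⟨c, x⟩ <;> rcases q with _ | ⟨d, y⟩
  · exact h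
  · exact h.elim
  · exact h.elim
  · exact h.1

theorem color_eq (h : Linked m r G H p q) :
    (rootedUnion κ a G).color p = (rootedUnion κ a H).color q := by
  rcases p with _ | ⟨c, x⟩ <;> rcases q with _ | ⟨d, y⟩
  · rfl
  · exact h.elim
  · exact h.elim
  · exact h.2.color_eq

theorem swap (h : Linked (m + 1) r G H p q) : Linked m r H G q p := by
  rcases p with _ | ⟨c, x⟩ <;> rcases q with _ | ⟨d, y⟩
  · exact Matchable.swap h
  · exact h
  · exact h
  · exact ⟨h.1.swap, h.2.swap⟩

theorem forth (h : Linked m (r + 1) G H p q) (p' : Option (ι × V)) :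
    ∃ q', SamePairType (rootedUnion κ a G) (rootedUnion κ a H) p p' q q' ∧
      Linked m r G H p' q' := by
  have hmatch : Matchable m r G H := h.matchable.mono (Nat.le_succ r)
  rcases p with _ | ⟨c, x⟩ <;> rcases q with _ | ⟨d, y⟩ <;> rcases p' with _ | ⟨c', x'⟩
  · exact ⟨none, samePairType_self, hmatch⟩
  · obtain ⟨d', -, hcov⟩ := hmatch.1 c' c'
    obtain ⟨y', hwin⟩ := hcov x'
    refine ⟨some (d', y'), ⟨by simp, ?_⟩, hmatch, hwin⟩
    exact iff_of_eq (congrArg (· = a) hwin.color_eq)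
  · exact h.elim
  · exact h.elim
  · exact h.elim
  · exact h.elim
  · refine ⟨none, ⟨by simp, ?_⟩, hmatch⟩
    exact iff_of_eq (congrArg (· = a) h.2.color_eq)
  · obtain rfl | hc := eq_or_ne c' c
    · obtain ⟨y', hpair, hwin⟩ := h.2.forth x'
      exact ⟨some (d, y'), ⟨by simp [hpair.1], by simp [rootedUnion, hpair.2]⟩, hmatch, hwin⟩
    · obtain ⟨d', hd, hcov⟩ := hmatch.1 c' d
      obtain ⟨y', hwin⟩ := hcov x'
      exact ⟨some (d', y'), ⟨by simp [hc.symm, hd.symm], by simp [rootedUnion, hc.symm, hd.symm]⟩,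
        hmatch, hwin⟩

theorem duplicatorWins (h : Linked m r G H p q) :
    DuplicatorWins m r (rootedUnion κ a G) (rootedUnion κ a H) p q := by
  induction r generalizing V W m with
  | zero => exact h.color_eq
  | succ r ih =>
    refine ⟨h.color_eq, fun p' => ?_, ?_⟩
    · obtain ⟨q', hpair, hlink⟩ := h.forth p'
      exact ⟨q', hpair, ih hlink⟩
    · rintro m' rfl q'
      obtain ⟨p', hpair, hlink⟩ := h.swap.forth q'
      exact ⟨p', hpair, ih hlink⟩

end Linked

theorem Matchable.duplicatorWins (h : Matchable m r G H) :
    DuplicatorWins m r (rootedUnion κ a G) (rootedUnion κ a H) none none :=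
  Linked.duplicatorWins (p := none) (q := none) h

theorem Matchable.covers (h : Matchable m r G H) :
    Covers m r (rootedUnion κ a G) (rootedUnion κ a H) := by
  rintro (_ | ⟨c, x⟩)
  · exact ⟨none, h.duplicatorWins⟩
  · obtain ⟨d, -, hcov⟩ := h.1 c c
    obtain ⟨y, hwin⟩ := hcov x
    exact ⟨some (d, y), Linked.duplicatorWins (p := some (c, x)) (q := some (d, y)) ⟨h, hwin⟩⟩

end RootedUnion

section Tree

/-- The labels of the three children of a tree labelled `b`: a tree labelled `false` has only
children labelled `true`, a tree labelled `true` has exactly one child labelled `false`. -/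
def childLabel (b : Bool) (c : Fin 3) : Bool := !(b && c = 2)

/-- The vertices of a ternary tree of height `i` whose leaves are copies of `V`. -/
def TreeVertex (V : Type) : ℕ → Type
  | 0 => V
  | i + 1 => Option (Fin 3 × TreeVertex V i)

/-- The ternary tree of height `i` and label `b`, whose leaves are copies of `base false` and
`base true`. The root of a tree of height `j` has color `lev j`; `lev 0` is the color of the
vertices of a leaf to which their parent is joined. -/
def tree (lev : ℕ → C) (base : Bool → ColoredGraph C V) :
    (i : ℕ) → Bool → ColoredGraph C (TreeVertex V i)
  | 0, b => base b
  | i + 1, b => rootedUnion (lev (i + 1)) (lev i) fun c => tree lev base i (childLabel b c)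

instance TreeVertex.finite [Finite V] : ∀ i, Finite (TreeVertex V i)
  | 0 => ‹Finite V›
  | i + 1 =>
    have := TreeVertex.finite i
    inferInstanceAs (Finite (Option (Fin 3 × TreeVertex V i)))

theorem TreeVertex.two_mul_card_add_one [Finite V] (i : ℕ) :
    2 * Nat.card (TreeVertex V i) + 1 = 3 ^ i * (2 * Nat.card V + 1) := by
  induction i with
  | zero => simp [TreeVertex]
  | succ i ih =>
    have hcard : Nat.card (TreeVertex V (i + 1)) = 3 * Nat.card (TreeVertex V i) + 1 := by
      rw [TreeVertex, Finite.card_option, Nat.card_prod, Nat.card_fin]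
    rw [hcard, pow_succ']
    linarith

theorem exists_ne_childLabel_eq_true (b : Bool) (d : Fin 3) : ∃ d' ≠ d, childLabel b d' = true := by
  decide +revert

variable {lev : ℕ → C} {base : Bool → ColoredGraph C V} {m r : ℕ}

theorem matchable_childLabel {F : Bool → ColoredGraph C V} {b b' : Bool}
    (h : b = true → Covers m r (F false) (F true))
    (h' : b' = true → ∀ m', m = m' + 1 → Covers m' r (F false) (F true)) :
    Matchable m r (fun c => F (childLabel b c)) (fun c => F (childLabel b' c)) := by
  have covers_child {m : ℕ} {b : Bool} (h : b = true → Covers m r (F false) (F true)) (c : Fin 3) :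
      Covers m r (F (childLabel b c)) (F true) := by
    cases hb : childLabel b c with
    | true => exact .refl m r _
    | false => exact h (by simp_all [childLabel])
  refine ⟨fun c d => ?_, fun m' hm d c => ?_⟩
  · obtain ⟨d', hd, htrue⟩ := exists_ne_childLabel_eq_true b' d
    exact ⟨d', hd, by simpa only [htrue] using covers_child h c⟩
  · obtain ⟨c', hc, htrue⟩ := exists_ne_childLabel_eq_true b c
    exact ⟨c', hc, by simpa only [htrue] using covers_child (fun hb => h' hb m' hm) d⟩

theorem covers_tree (hbase : Covers 0 r (base false) (base true)) {i : ℕ} (hm : m ≤ i) :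
    Covers m r (tree lev base i false) (tree lev base i true) := by
  induction i generalizing m with
  | zero =>
    obtain rfl := Nat.le_zero.1 hm
    exact hbase
  | succ i ih =>
    exact (matchable_childLabel (by simp) fun _ m' hm' => ih (by omega)).covers

theorem duplicatorWins_tree (hbase : Covers 0 r (base false) (base true)) (m : ℕ) :
    DuplicatorWins m r (tree lev base (m + 1) true) (tree lev base (m + 1) false) none none :=
  (matchable_childLabel (fun _ => covers_tree hbase le_rfl) (by simp)).duplicatorWins

end Tree

section Modal

/-- Modal formulas over the colors in `C`, a source of formulas of `FO²` whose models are easy to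
compute. -/
inductive ModalFormula (C : Type)
  | top
  | neg (φ : ModalFormula C)
  | dia (a : C) (φ : ModalFormula C)

namespace ModalFormula

/-- Truth of a modal formula at a vertex: `dia a φ` says that `φ` holds at a neighbor of
color `a`. -/
def Holds (G : ColoredGraph C V) : ModalFormula C → V → Prop
  | top, _ => True
  | neg φ, x => ¬ φ.Holds G x
  | dia a φ, x => ∃ y, G.graph.Adj x y ∧ G.color y = a ∧ φ.Holds G y

/-- The standard translation of a modal formula to a formula with the free variable `k`. -/
def toFormula : ModalFormula C → Fin 2 → Formula C 2
  | top, k => .atom (.eq k k)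
  | neg φ, k => (φ.toFormula k).neg
  | dia a φ, k => .quant .ex (1 - k) <|
      .and (.atom (.adj k (1 - k))) (.and (.atom (.col a (1 - k))) (φ.toFormula (1 - k)))

theorem sat_toFormula (G : ColoredGraph C V) (φ : ModalFormula C) (k : Fin 2) (v : Fin 2 → V) :
    (φ.toFormula k).Sat G v ↔ φ.Holds G (v k) := by
  induction φ generalizing k v with
  | top => simp [toFormula, Holds, Formula.Sat, Atom.Sat]
  | neg φ ih => rw [toFormula, Formula.sat_neg, ih, Holds]
  | dia a φ ih =>
    have hk : k ≠ 1 - k := by decide +revert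
    simp [toFormula, Holds, Formula.Sat, Atom.Sat, ih, hk]

theorem freeVars_toFormula (φ : ModalFormula C) (k : Fin 2) : (φ.toFormula k).freeVars ⊆ {k} := by
  induction φ generalizing k with
  | top => simp [toFormula, Formula.freeVars, Atom.vars]
  | neg φ ih => simpa only [toFormula, Formula.freeVars_neg] using ih k
  | dia a φ ih =>
    intro l hl
    have := @ih (1 - k) l
    simp_all [toFormula, Formula.freeVars, Atom.vars]

/-- The sentence saying that `φ` holds at a vertex of color `κ`. -/
def existsOfColor (κ : C) (φ : ModalFormula C) : Formula C 2 :=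
  .quant .ex 0 (.and (.atom (.col κ 0)) (φ.toFormula 0))

theorem existsOfColor_isSentence (κ : C) (φ : ModalFormula C) :
    (φ.existsOfColor κ).IsSentence := by
  refine Finset.erase_eq_empty_iff _ _ |>.2 <| Finset.subset_singleton_iff.1 ?_
  exact Finset.union_subset subset_rfl (φ.freeVars_toFormula 0)

theorem sat_existsOfColor (G : ColoredGraph C V) (κ : C) (φ : ModalFormula C) (v : Fin 2 → V) :
    (φ.existsOfColor κ).Sat G v ↔ ∃ x, G.color x = κ ∧ φ.Holds G x := by
  simp [existsOfColor, Formula.Sat, Atom.Sat, sat_toFormula]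

theorem existsOfColor_distinguishes {G : ColoredGraph C V} {H : ColoredGraph C W} [Nonempty W]
    {κ : C} {φ : ModalFormula C} (hG : ∃ x, G.color x = κ ∧ φ.Holds G x)
    (hH : ∀ x, H.color x = κ → ¬ φ.Holds H x) : (φ.existsOfColor κ).Distinguishes G H := by
  refine ⟨existsOfColor_isSentence κ φ, fun v => (sat_existsOfColor G κ φ v).2 hG, fun htrue => ?_⟩
  obtain ⟨x, hκ, hφ⟩ := (sat_existsOfColor H κ φ _).1 (htrue fun _ => Classical.arbitrary W)
  exact hH x hκ hφ

/-- `walk f n j` says that there is a walk of length `n` whose vertices after the first one have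
the colors `f (j + 1)`, …, `f (j + n)`. -/
def walk (f : ℕ → C) : ℕ → ℕ → ModalFormula C
  | 0, _ => top
  | n + 1, j => dia (f (j + 1)) (walk f n (j + 1))

/-- `node f φ j` holds at the root of a tree of height `j`, whose levels have the colors `f`, if
the player to move wins the following game: two players take turns in descending the tree, and
whoever is to move at a leaf wins if and only if `φ` fails there. -/
def node (f : ℕ → C) (φ : ModalFormula C) : ℕ → ModalFormula C
  | 0 => neg φ
  | j + 1 => dia (f j) (neg (node f φ j))

theorem alternations_walk (f : ℕ → C) (n j : ℕ) (k : Fin 2) :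
    ((walk f n j).toFormula k).alternations .ex = 0 := by
  induction n generalizing j k with
  | zero => rfl
  | succ n ih => simp [walk, toFormula, Formula.alternations, ih]

theorem alternations_node {φ : ModalFormula C}
    (hφ : ∀ k, (φ.toFormula k).alternations .ex = 0) (f : ℕ → C) (j : ℕ) (k : Fin 2) :
    ((node f φ j).toFormula k).alternations .all = j := by
  induction j generalizing k with
  | zero => simp [node, toFormula, Formula.alternations_neg, Quant.dual, hφ]
  | succ j ih =>
    simp [node, toFormula, Formula.alternations, Formula.alternations_neg, Quant.dual, ih,
      add_comm]

theorem existsOfColor_node_mem_sigmaFO {φ : ModalFormula C}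
    (hφ : ∀ k, (φ.toFormula k).alternations .ex = 0) (f : ℕ → C) (κ : C) (j : ℕ) :
    ((node f φ (j + 1)).existsOfColor κ) ∈ sigmaFO C (j + 1) 2 := by
  refine ⟨rfl, ?_⟩
  simp [existsOfColor, node, toFormula, Formula.alternations, Formula.alternations_neg, Quant.dual,
    alternations_node hφ]

end ModalFormula

end Modal

section NodeFormula

open ModalFormula

variable {κ a : C} {ρ : C → D}

theorem holds_dia_rootedUnion_some {ι : Type} {G : ι → ColoredGraph C V} {c : ι} {x : V} {b : D}
    (h : (G c).color x = a → ρ κ ≠ b) (φ : ModalFormula D) :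
    (dia b φ).Holds ((rootedUnion κ a G).map ρ) (some (c, x)) ↔
      ∃ y, (G c).graph.Adj x y ∧ ρ ((G c).color y) = b ∧
        φ.Holds ((rootedUnion κ a G).map ρ) (some (c, y)) := by
  constructor
  · rintro ⟨_ | ⟨d, y⟩, hadj, hcol, hφ⟩
    · exact absurd hcol (h hadj)
    · obtain ⟨rfl, hadj⟩ := hadj
      exact ⟨y, hadj, hcol, hφ⟩
  · rintro ⟨y, hadj, hcol, hφ⟩
    exact ⟨some (c, y), ⟨rfl, hadj⟩, hcol, hφ⟩

theorem holds_walk_rootedUnion_some {ι : Type} {f : ℕ → D} (h : ∀ n, ρ κ ≠ f n)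
    (G : ι → ColoredGraph C V) (n j : ℕ) (c : ι) (x : V) :
    (walk f n j).Holds ((rootedUnion κ a G).map ρ) (some (c, x)) ↔
      (walk f n j).Holds ((G c).map ρ) x := by
  induction n generalizing j x with
  | zero => exact Iff.rfl
  | succ n ih =>
    rw [walk, holds_dia_rootedUnion_some fun _ => h (j + 1)]
    simp only [ih]
    exact Iff.rfl

theorem holds_node_rootedUnion_some {ι : Type} {lev : ℕ → C} {G : ι → ColoredGraph C V} {c : ι}
    {φ : ModalFormula D}
    (hφ : ∀ x, φ.Holds ((rootedUnion κ a G).map ρ) (some (c, x)) ↔ φ.Holds ((G c).map ρ) x)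
    (hlev : ∀ l, ρ (lev (l + 1)) = ρ a → ρ κ ≠ ρ (lev l)) {l : ℕ} {x : V}
    (hx : ρ ((G c).color x) = ρ (lev l)) :
    (node (ρ ∘ lev) φ l).Holds ((rootedUnion κ a G).map ρ) (some (c, x)) ↔
      (node (ρ ∘ lev) φ l).Holds ((G c).map ρ) x := by
  induction l generalizing x with
  | zero => exact not_congr (hφ x)
  | succ l ih =>
    refine (holds_dia_rootedUnion_some (fun hxa => hlev l (by rw [← hx, hxa])) _).trans ?_
    exact exists_congr fun y => and_congr_right fun _ => and_congr_right fun hy =>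
      not_congr (ih hy)

/-- The colors of the levels of a tree allow the formulas `node` to recognize the levels, even
after the colors have been identified along `ρ`. -/
structure IsLevelColoring (lev : ℕ → C) (base : Bool → ColoredGraph C V) (ρ : C → D) : Prop where
  injective : Function.Injective lev
  base_color_ne (b : Bool) (x : V) (l : ℕ) : (base b).color x ≠ lev (l + 1)
  map_ne {j l : ℕ} : ρ (lev (l + 1)) = ρ (lev j) → ρ (lev (j + 1)) ≠ ρ (lev l)

variable {lev : ℕ → C} {base : Bool → ColoredGraph C V} {f : ℕ → D} {n : ℕ}

theorem IsLevelColoring.color_ne (h : IsLevelColoring lev base ρ) {i l : ℕ} (hl : i < l) (b : Bool)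
    (x : TreeVertex V i) : (tree lev base i b).color x ≠ lev l := by
  induction i generalizing b with
  | zero =>
    obtain ⟨l, rfl⟩ := Nat.exists_eq_add_of_lt hl
    exact h.base_color_ne b x _
  | succ i ih =>
    rcases x with _ | ⟨c, x⟩
    · exact h.injective.ne hl.ne
    · exact ih (Nat.lt_of_succ_lt hl) _ x

theorem IsLevelColoring.eq_none (h : IsLevelColoring lev base ρ) {i : ℕ} {b : Bool}
    {x : TreeVertex V (i + 1)} (hx : (tree lev base (i + 1) b).color x = lev (i + 1)) :
    x = none := by
  rcases x with _ | ⟨c, x⟩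
  · rfl
  · exact absurd hx (h.color_ne (Nat.lt_succ_self i) _ x)

theorem holds_node_succ_root_iff (h : IsLevelColoring lev base ρ)
    (hf : ∀ l n, ρ (lev (l + 1)) ≠ f n) (i : ℕ) (b : Bool) :
    (node (ρ ∘ lev) (walk f n 0) (i + 1)).Holds ((tree lev base (i + 1) b).map ρ) none ↔
      ∃ c y, (tree lev base i (childLabel b c)).color y = lev i ∧
        ¬ (node (ρ ∘ lev) (walk f n 0) i).Holds ((tree lev base i (childLabel b c)).map ρ) y := by
  have transfer (c : Fin 3) (y : TreeVertex V i)
      (hy : (tree lev base i (childLabel b c)).color y = lev i) :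
      (node (ρ ∘ lev) (walk f n 0) i).Holds ((tree lev base (i + 1) b).map ρ) (some (c, y)) ↔
        (node (ρ ∘ lev) (walk f n 0) i).Holds ((tree lev base i (childLabel b c)).map ρ) y :=
    holds_node_rootedUnion_some (holds_walk_rootedUnion_some (hf i) _ n 0 c)
      (fun l => h.map_ne) (congrArg ρ hy)
  constructor
  · rintro ⟨_ | ⟨c, y⟩, hadj, -, hnode⟩
    · exact hadj.elim
    · exact ⟨c, y, hadj, mt (transfer c y hadj).2 hnode⟩
  · rintro ⟨c, y, hy, hnode⟩
    exact ⟨some (c, y), hy, congrArg ρ hy, mt (transfer c y hy).1 hnode⟩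

theorem exists_childLabel_eq_false_iff (b : Bool) : (∃ c, childLabel b c = false) ↔ b = true := by
  decide +revert

theorem exists_not_holds_node_iff (h : IsLevelColoring lev base ρ)
    (hf : ∀ l n, ρ (lev (l + 1)) ≠ f n)
    (hbase : ∀ b, (∃ y, (base b).color y = lev 0 ∧ (walk f n 0).Holds ((base b).map ρ) y) ↔
      b = false) (i : ℕ) (b : Bool) :
    (∃ y, (tree lev base i b).color y = lev i ∧
      ¬ (node (ρ ∘ lev) (walk f n 0) i).Holds ((tree lev base i b).map ρ) y) ↔ b = false := by
  induction i generalizing b with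
  | zero =>
    simp only [node, Holds, not_not]
    exact hbase b
  | succ i ih =>
    have hroot := holds_node_succ_root_iff (n := n) h hf i b
    simp only [ih, exists_childLabel_eq_false_iff] at hroot
    rw [← Bool.not_eq_true, ← hroot]
    constructor
    · rintro ⟨y, hy, hnode⟩
      exact h.eq_none hy ▸ hnode
    · exact fun hnode => ⟨none, rfl, hnode⟩

theorem existsOfColor_node_distinguishes (h : IsLevelColoring lev base ρ)
    (hf : ∀ l n, ρ (lev (l + 1)) ≠ f n)
    (hbase : ∀ b, (∃ y, (base b).color y = lev 0 ∧ (walk f n 0).Holds ((base b).map ρ) y) ↔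
      b = false) {i : ℕ} (hi : ∀ z, ρ z = ρ (lev (i + 1)) → z = lev (i + 1)) :
    ((node (ρ ∘ lev) (walk f n 0) (i + 1)).existsOfColor (ρ (lev (i + 1)))).Distinguishes
      ((tree lev base (i + 1) true).map ρ) ((tree lev base (i + 1) false).map ρ) := by
  have hnode (b : Bool) := holds_node_succ_root_iff (n := n) h hf i b
  simp only [exists_not_holds_node_iff h hf hbase, exists_childLabel_eq_false_iff] at hnode
  have : Nonempty (TreeVertex V (i + 1)) := ⟨none⟩
  refine existsOfColor_distinguishes ⟨none, rfl, (hnode true).2 rfl⟩ fun x hx => ?_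
  obtain rfl := h.eq_none (hi _ hx)
  exact mt (hnode false).1 (by decide)

end NodeFormula

section Cycle

/-- Reduction modulo `3`, the color class of a position on a cycle of length `3 * k`. -/
def residue (k : ℕ) : ZMod (3 * k) →+* ZMod 3 :=
  ZMod.castHom (dvd_mul_right 3 k) (ZMod 3)

/-- The blow-up of the cycle of length `3 * k`: every vertex `x` has a position on the cycle, and
vertices at consecutive positions are joined. The colors record the position modulo `3`, so that
they determine an orientation, and whether the vertex is marked. -/
def blowup {k : ℕ} (pos : V → ZMod (3 * k)) (marked : V → Bool) :
    ColoredGraph (ZMod 3 × Bool) V where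
  graph :=
    { Adj := fun x y => pos y = pos x + 1 ∨ pos x = pos y + 1
      symm := ⟨fun _ _ => Or.symm⟩
      loopless := ⟨fun x h => by
        have hres : residue k (pos x) = residue k (pos x) + 1 := by
          rw [← map_one (residue k), ← map_add]
          exact congrArg _ (or_self_iff.1 h)
        exact absurd (left_eq_add.1 hres) (by decide)⟩ }
  color x := (residue k (pos x), marked x)

/-- The cycle of length `3 * P` with a single marked vertex. -/
def longCycle (P : ℕ) : ColoredGraph (ZMod 3 × Bool) (ZMod (3 * P)) :=
  blowup id fun x => decide (x = 0)

/-- The vertices of a cycle of length `3 * Q` in which every vertex at a nonzero position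
divisible by `3` has a marked twin. -/
abbrev ShortVertex (Q : ℕ) : Type :=
  ZMod (3 * Q) ⊕ {a : (residue Q).toAddMonoidHom.ker // a ≠ 0}

/-- The position of a vertex on the cycle of length `3 * Q`. -/
def ShortVertex.pos {Q : ℕ} : ShortVertex Q → ZMod (3 * Q) :=
  Sum.elim id fun a => a.1.1

/-- The cycle of length `3 * Q` with marked twins, with its vertices renamed along `v`. -/
def shortCycle {Q : ℕ} (v : V → ShortVertex Q) : ColoredGraph (ZMod 3 × Bool) V :=
  blowup (fun x => (v x).pos) fun x => (v x).isRight

/-- The long cycle at `x` and the short cycle at `s` look the same to distance `r`: walking along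
the cycles in parallel one has arrived at `x` and `s` after `τ` steps from the position `0`, and the
next time both positions are `0` again is after `3 * (P * Q)` steps. -/
def InPhase {P Q : ℕ} (r : ℕ) (x : ZMod (3 * P)) (s : ShortVertex Q) : Prop :=
  ∃ τ : ℤ, r < τ ∧ τ + r < (3 * (P * Q) : ℕ) ∧ (τ : ZMod (3 * P)) = x ∧ (τ : ZMod (3 * Q)) = s.pos ∧
    s.isRight = decide (x = 0)

theorem ShortVertex.card (Q : ℕ) [NeZero Q] : Nat.card (ShortVertex Q) = 3 * Q + (Q - 1) := by
  have hindex : (residue Q).toAddMonoidHom.ker.index = 3 := by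
    rw [AddSubgroup.index_ker, AddMonoidHom.range_eq_top.2 (ZMod.ringHom_surjective _),
      AddSubgroup.card_top, Nat.card_zmod]
  have hker : Nat.card (residue Q).toAddMonoidHom.ker = Q := by
    have := (residue Q).toAddMonoidHom.ker.card_mul_index
    rw [hindex, Nat.card_zmod] at this
    omega
  have hne : Nat.card {a : (residue Q).toAddMonoidHom.ker // a ≠ 0} = Q - 1 := by
    have := Set.ncard_compl {(0 : (residue Q).toAddMonoidHom.ker)}
    rwa [Set.ncard_singleton, hker] at this
  rw [Nat.card_sum, Nat.card_zmod, hne]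

variable {k P Q r : ℕ}

theorem exists_intCast_eq {n : ℕ} [NeZero n] (x : ZMod n) (a : ℤ) :
    ∃ τ : ℤ, a ≤ τ ∧ τ < a + n ∧ (τ : ZMod n) = x := by
  refine ⟨a + (x - (a : ZMod n)).val, by omega, ?_, by simp⟩
  have := ZMod.val_lt (x - (a : ZMod n))
  omega

theorem longCycle_adj {x y : ZMod (3 * P)} :
    (longCycle P).graph.Adj x y ↔ y = x + 1 ∨ x = y + 1 := Iff.rfl

theorem shortCycle_adj {v : V → ShortVertex Q} {x y : V} :
    (shortCycle v).graph.Adj x y ↔ (v y).pos = (v x).pos + 1 ∨ (v x).pos = (v y).pos + 1 := Iff.rfl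

theorem eq_of_residue_eq {δ ε : ZMod (3 * k)} (hδ : δ = 0 ∨ δ = 1 ∨ δ = -1)
    (hε : ε = 0 ∨ ε = 1 ∨ ε = -1) (h : residue k δ = residue k ε) : δ = ε := by
  rcases hδ with rfl | rfl | rfl <;> rcases hε with rfl | rfl | rfl <;>
    first
      | rfl
      | exact absurd h (by simp only [map_zero, map_one, map_neg]; decide)

theorem intCast_ne_zero_of_intCast_eq_zero (hPQ : P.Coprime Q) {τ : ℤ} (hpos : 0 < τ)
    (hlt : τ < (3 * (P * Q) : ℕ)) (h : (τ : ZMod (3 * P)) = 0) : (τ : ZMod (3 * Q)) ≠ 0 := by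
  rw [ZMod.intCast_zmod_eq_zero_iff_dvd, Nat.cast_mul] at h
  rw [Ne, ZMod.intCast_zmod_eq_zero_iff_dvd, Nat.cast_mul]
  intro h'
  obtain ⟨w, rfl⟩ := (dvd_mul_right (3 : ℤ) P).trans h
  have hdvd : ((P * Q : ℕ) : ℤ) ∣ w := by
    rw [Nat.cast_mul]
    exact (Nat.isCoprime_iff_coprime.2 hPQ).mul_dvd (Int.dvd_of_mul_dvd_mul_left three_ne_zero h)
      (Int.dvd_of_mul_dvd_mul_left three_ne_zero h')
  have := Int.le_of_dvd (by omega) hdvd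
  omega

theorem InPhase.mono {r' : ℕ} (hr : r' ≤ r) {x : ZMod (3 * P)} {s : ShortVertex Q}
    (h : InPhase r x s) : InPhase r' x s := by
  obtain ⟨τ, hlow, hhigh, hτ⟩ := h
  exact ⟨τ, by omega, by omega, hτ⟩

theorem exists_inPhase (hPQ : P.Coprime Q) {τ : ℤ} (hlow : r < τ)
    (hhigh : τ + r < (3 * (P * Q) : ℕ)) :
    ∃ s : ShortVertex Q, s.pos = τ ∧ InPhase r (τ : ZMod (3 * P)) s := by
  by_cases h0 : (τ : ZMod (3 * P)) = 0
  · have hres : (τ : ZMod (3 * Q)) ∈ (residue Q).toAddMonoidHom.ker := by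
      have : residue Q τ = 0 := by
        rw [map_intCast, ← map_intCast (residue P), h0, map_zero]
      exact this
    have hne : (⟨τ, hres⟩ : (residue Q).toAddMonoidHom.ker) ≠ 0 := by
      rw [Ne, Subtype.ext_iff]
      exact intCast_ne_zero_of_intCast_eq_zero hPQ (by omega) (by omega) h0
    exact ⟨.inr ⟨_, hne⟩, rfl, τ, hlow, hhigh, rfl, rfl, by simp [h0]⟩
  · exact ⟨.inl τ, rfl, τ, hlow, hhigh, rfl, rfl, by simp [h0]⟩

theorem exists_not_close (hPQ : P.Coprime Q) (hQ : 1 < Q) (p : ZMod (3 * Q)) (σ : ℤ) :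
    ∃ τ : ℤ, (τ = σ ∨ τ = σ + (3 * P : ℕ)) ∧
      ¬ ((τ - p : ZMod (3 * Q)) = 0 ∨ (τ - p : ZMod (3 * Q)) = 1 ∨
        (τ - p : ZMod (3 * Q)) = -1) := by
  by_contra! hclose
  have heq : (σ - p : ZMod (3 * Q)) = (σ + (3 * P : ℕ) : ℤ) - p := by
    refine eq_of_residue_eq (hclose σ (.inl rfl)) (hclose _ (.inr rfl)) ?_
    rw [map_sub, map_sub, map_intCast, map_intCast]
    push_cast
    rw [show (3 : ZMod 3) = 0 from rfl, zero_mul, add_zero]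
  have hdvd : 3 * Q ∣ 3 * P := by
    rw [← ZMod.natCast_eq_zero_iff]
    push_cast at heq ⊢
    linear_combination -heq
  exact hQ.ne' (Nat.eq_one_of_dvd_coprimes hPQ (Nat.dvd_of_mul_dvd_mul_left three_pos hdvd) dvd_rfl)

theorem InPhase.color_eq {v : V → ShortVertex Q} {x : ZMod (3 * P)} {y : V}
    (h : InPhase r x (v y)) : (longCycle P).color x = (shortCycle v).color y := by
  obtain ⟨τ, -, -, rfl, hpos, hmarked⟩ := h
  refine Prod.ext ?_ hmarked.symm
  change residue P τ = residue Q (v y).pos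
  rw [← hpos, map_intCast, map_intCast]

theorem InPhase.forth_of_adj (hPQ : P.Coprime Q) {v : V → ShortVertex Q}
    (hv : Function.Surjective v) {x x' : ZMod (3 * P)} {y : V} (h : InPhase (r + 1) x (v y))
    (hadj : (longCycle P).graph.Adj x x') :
    ∃ y', (shortCycle v).graph.Adj y y' ∧ InPhase r x' (v y') := by
  obtain ⟨τ, hlow, hhigh, rfl, hpos, -⟩ := h
  obtain ⟨τ', hτ', rfl⟩ :
      ∃ τ' : ℤ, (τ' = τ + 1 ∨ τ = τ' + 1) ∧ (τ' : ZMod (3 * P)) = x' := by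
    rcases longCycle_adj.1 hadj with rfl | hx'
    · exact ⟨τ + 1, .inl rfl, by push_cast; rfl⟩
    · exact ⟨τ - 1, .inr (by ring), by rw [Int.cast_sub, hx', Int.cast_one, add_sub_cancel_right]⟩
  obtain ⟨s, hs, hphase⟩ := exists_inPhase (r := r) (τ := τ') hPQ (by omega) (by omega)
  obtain ⟨y', rfl⟩ := hv s
  refine ⟨y', ?_, hphase⟩
  rw [shortCycle_adj, hs, ← hpos]
  exact_mod_cast hτ'.imp (congrArg _) (congrArg _)

theorem exists_inPhase_of_not_adj (hPQ : P.Coprime Q) (hQ : 1 < Q)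
    (hr : 2 * (r + 1) + 6 * P < 3 * (P * Q)) {v : V → ShortVertex Q} (hv : Function.Surjective v)
    (x' : ZMod (3 * P)) (y : V) :
    ∃ y', y ≠ y' ∧ ¬ (shortCycle v).graph.Adj y y' ∧ InPhase r x' (v y') := by
  have : NeZero P := ⟨by rintro rfl; simp at hr⟩
  obtain ⟨σ, hσlow, hσhigh, rfl⟩ := exists_intCast_eq x' (r + 1)
  obtain ⟨τ, hτ, hclose⟩ := exists_not_close hPQ hQ (v y).pos σ
  have hτσ : (τ : ZMod (3 * P)) = σ := by
    rcases hτ with rfl | rfl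
    · rfl
    · rw [Int.cast_add, Int.cast_natCast, ZMod.natCast_self, add_zero]
  obtain ⟨s, hs, hphase⟩ := exists_inPhase (r := r) (τ := τ) hPQ (by omega) (by omega)
  obtain ⟨y', rfl⟩ := hv s
  refine ⟨y', ?_, ?_, hτσ ▸ hphase⟩
  · rintro rfl
    exact hclose (.inl (by rw [hs, sub_self]))
  · rw [shortCycle_adj, hs]
    rintro (h | h)
    · exact hclose (.inr (.inl (by linear_combination h)))
    · exact hclose (.inr (.inr (by linear_combination -h)))

theorem InPhase.forth (hPQ : P.Coprime Q) (hQ : 1 < Q) (hr : 2 * (r + 1) + 6 * P < 3 * (P * Q))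
    {v : V → ShortVertex Q} (hv : Function.Surjective v) {x : ZMod (3 * P)} {y : V}
    (h : InPhase (r + 1) x (v y)) (x' : ZMod (3 * P)) :
    ∃ y', SamePairType (longCycle P) (shortCycle v) x x' y y' ∧ InPhase r x' (v y') := by
  obtain rfl | hne := eq_or_ne x x'
  · exact ⟨y, samePairType_self, h.mono (Nat.le_succ r)⟩
  by_cases hadj : (longCycle P).graph.Adj x x'
  · obtain ⟨y', hadj', hphase⟩ := h.forth_of_adj hPQ hv hadj
    exact ⟨y', ⟨iff_of_false hne hadj'.ne, iff_of_true hadj hadj'⟩, hphase⟩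
  · obtain ⟨y', hne', hadj', hphase⟩ := exists_inPhase_of_not_adj hPQ hQ hr hv x' y
    exact ⟨y', ⟨iff_of_false hne hne', iff_of_false hadj hadj'⟩, hphase⟩

theorem InPhase.duplicatorWins (hPQ : P.Coprime Q) (hQ : 1 < Q) (hr : 2 * r + 6 * P < 3 * (P * Q))
    {v : V → ShortVertex Q} (hv : Function.Surjective v) {x : ZMod (3 * P)} {y : V}
    (h : InPhase r x (v y)) : DuplicatorWins 0 r (longCycle P) (shortCycle v) x y := by
  induction r generalizing x y with
  | zero => exact h.color_eq
  | succ r ih =>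
    refine ⟨h.color_eq, fun x' => ?_, by omega⟩
    obtain ⟨y', hpair, hphase⟩ := h.forth hPQ hQ hr hv x'
    exact ⟨y', hpair, ih (by omega) hphase⟩

theorem covers_longCycle_shortCycle (hPQ : P.Coprime Q) (hQ : 1 < Q)
    (hr : 2 * r + 6 * P < 3 * (P * Q)) {v : V → ShortVertex Q} (hv : Function.Surjective v) :
    Covers 0 r (longCycle P) (shortCycle v) := by
  intro x
  have : NeZero P := ⟨by rintro rfl; simp at hr⟩
  obtain ⟨τ, hlow, hhigh, rfl⟩ := exists_intCast_eq x (r + 1)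
  obtain ⟨s, -, hphase⟩ := exists_inPhase (r := r) (τ := τ) hPQ (by omega) (by omega)
  obtain ⟨y, rfl⟩ := hv s
  exact ⟨y, hphase.duplicatorWins hPQ hQ hr hv⟩

end Cycle

section CycleWalk

namespace ModalFormula

theorem holds_walk_of_adj {G : ColoredGraph C V} {f : ℕ → C} {w : ℕ → V}
    (hadj : ∀ j, G.graph.Adj (w j) (w (j + 1))) (hcolor : ∀ j, G.color (w j) = f j) (n j : ℕ) :
    (walk f n j).Holds G (w j) := by
  induction n generalizing j with
  | zero => trivial
  | succ n ih => exact ⟨w (j + 1), hadj j, hcolor (j + 1), ih (j + 1)⟩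

theorem exists_of_holds_walk {G : ColoredGraph C V} {f : ℕ → C} {I : ℕ → V → Prop}
    (hI : ∀ j x y, I j x → G.graph.Adj x y → G.color y = f (j + 1) → I (j + 1) y) {n j k : ℕ}
    {x : V} (hx : I j x) (hwalk : (walk f n j).Holds G x) (hk : k ≤ n) : ∃ y, I (j + k) y := by
  induction n generalizing j k x with
  | zero =>
    obtain rfl := Nat.le_zero.1 hk
    exact ⟨x, hx⟩
  | succ n ih =>
    obtain _ | k := k
    · exact ⟨x, hx⟩
    · obtain ⟨y, hadj, hcolor, hwalk⟩ := hwalk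
      rw [← Nat.succ_add_eq_add_succ]
      exact ih (hI j x y hx hadj hcolor) hwalk (Nat.le_of_succ_le_succ hk)

theorem holds_walk_map {g : C → D} (hg : Function.Injective g) (G : ColoredGraph C V) (f : ℕ → C)
    (n j : ℕ) (x : V) : (walk (g ∘ f) n j).Holds (G.map g) x ↔ (walk f n j).Holds G x := by
  induction n generalizing j x with
  | zero => exact Iff.rfl
  | succ n ih =>
    exact exists_congr fun y => and_congr_right fun _ => and_congr hg.eq_iff (ih (j + 1) y)

end ModalFormula

open ModalFormula

variable {P Q : ℕ}

/-- The colors seen on an infinite walk around the long cycle from its marked vertex. -/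
def cycleColor (P j : ℕ) : ZMod 3 × Bool :=
  (longCycle P).color j

theorem holds_walk_longCycle (n : ℕ) : (walk (cycleColor P) n 0).Holds (longCycle P) 0 := by
  have := holds_walk_of_adj (G := longCycle P) (f := cycleColor P) (w := fun j => (j : ZMod _))
    (fun j => longCycle_adj.2 (.inl (by push_cast; rfl))) (fun _ => rfl) n 0
  simpa only [Nat.cast_zero] using this

theorem pos_eq_add_one_of_adj {v : V → ShortVertex Q} {x y : V}
    (hadj : (shortCycle v).graph.Adj x y)
    (hres : residue Q (v y).pos = residue Q (v x).pos + 1) : (v y).pos = (v x).pos + 1 := by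
  refine (shortCycle_adj.1 hadj).resolve_right fun h => ?_
  rw [h, map_add, map_one, add_assoc, left_eq_add] at hres
  exact absurd hres (by decide)

theorem exists_nat_add_mul_eq_zero (hPQ : P.Coprime Q) [NeZero Q] {p : ZMod (3 * Q)}
    (hp : residue Q p = 0) : ∃ k < Q, p + (3 * P * k : ℕ) = 0 := by
  obtain ⟨w, hw⟩ : 3 ∣ p.val := by
    rw [← ZMod.natCast_eq_zero_iff, ← hp, ← map_natCast (residue Q), ZMod.natCast_zmod_val]
  refine ⟨(-w * (P : ZMod Q)⁻¹).val, ZMod.val_lt _, ?_⟩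
  rw [← ZMod.natCast_zmod_val p, hw, ← Nat.cast_add, ZMod.natCast_eq_zero_iff, mul_assoc, ← mul_add]
  refine mul_dvd_mul_left 3 ?_
  rw [← ZMod.natCast_eq_zero_iff]
  push_cast
  rw [ZMod.natCast_zmod_val]
  linear_combination -(w : ZMod Q) * ZMod.coe_mul_inv_eq_one P hPQ

theorem ShortVertex.pos_ne_zero {s : ShortVertex Q} (hs : s.isRight = true) : s.pos ≠ 0 := by
  obtain ⟨a, rfl⟩ := Sum.isRight_iff.1 hs
  exact fun h => a.2 (Subtype.ext h)

theorem exists_pos_eq_of_holds_walk {v : V → ShortVertex Q} {x : V}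
    (hx : (shortCycle v).color x = (0, true)) {n k : ℕ}
    (hwalk : (walk (cycleColor P) n 0).Holds (shortCycle v) x) (hk : k ≤ n) :
    ∃ y, (v y).pos = (v x).pos + k ∧ (v y).isRight = decide ((k : ZMod (3 * P)) = 0) := by
  have hres : residue Q (v x).pos = 0 := congrArg Prod.fst hx
  have hmarked : (v x).isRight = true := congrArg Prod.snd hx
  let I (j : ℕ) (y : V) : Prop :=
    (v y).pos = (v x).pos + j ∧ (v y).isRight = decide ((j : ZMod (3 * P)) = 0)
  have hI (j : ℕ) (y z : V) (hy : I j y) (hadj : (shortCycle v).graph.Adj y z)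
      (hcolor : (shortCycle v).color z = cycleColor P (j + 1)) : I (j + 1) z := by
    have hstep : residue Q (v z).pos = residue Q (v y).pos + 1 := calc
      residue Q (v z).pos = residue P ((j + 1 : ℕ) : ZMod (3 * P)) := congrArg Prod.fst hcolor
      _ = residue Q (v y).pos + 1 := by
        rw [hy.1, map_add, hres, map_natCast, map_natCast, zero_add, Nat.cast_succ]
    refine ⟨?_, congrArg Prod.snd hcolor⟩
    rw [pos_eq_add_one_of_adj hadj hstep, hy.1, Nat.cast_succ, add_assoc]
  have hstart : I 0 x :=
    ⟨by rw [Nat.cast_zero, add_zero], hmarked.trans (by rw [Nat.cast_zero, decide_eq_true rfl])⟩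
  simpa only [I, zero_add] using exists_of_holds_walk hI hstart hwalk hk

theorem not_holds_walk_shortCycle (hPQ : P.Coprime Q) [NeZero Q] {v : V → ShortVertex Q} {x : V}
    (hx : (shortCycle v).color x = (0, true)) :
    ¬ (walk (cycleColor P) (3 * P * Q) 0).Holds (shortCycle v) x := by
  intro hwalk
  obtain ⟨k, hk, hzero⟩ :=
    exists_nat_add_mul_eq_zero hPQ (show residue Q (v x).pos = 0 from congrArg Prod.fst hx)
  obtain ⟨y, hpos, hmarked⟩ :=
    exists_pos_eq_of_holds_walk hx hwalk (Nat.mul_le_mul_left (3 * P) hk.le)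
  refine ShortVertex.pos_ne_zero (hmarked.trans (decide_eq_true ?_)) (hpos.trans hzero)
  rw [Nat.cast_mul, ZMod.natCast_self, zero_mul]

end CycleWalk

section Construction

/-- The colors of the vertices of the cycles, together with colors for the inner levels of a tree:
the level of the root is colored `none`, the other ones are colored modulo `3`. -/
abbrev Palette : Type := (ZMod 3 × Bool) ⊕ Option (ZMod 3)

/-- The colors of the levels of a tree before they are merged into finitely many. The level `0`
consists of the marked vertices of the leaves at positions divisible by `3`. -/
def levelColor : ℕ → (ZMod 3 × Bool) ⊕ ℕ
  | 0 => .inl (0, true)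
  | j + 1 => .inr j

/-- Merges the colors of the levels of a tree of height `m + 1` into the palette. -/
def mergeLevels (m : ℕ) : (ZMod 3 × Bool) ⊕ ℕ → Palette :=
  Sum.map id fun j => if j = m then none else some j

/-- The two kinds of leaves of a tree: a long cycle and a short cycle with marked twins. -/
def leaf (P : ℕ) {Q : ℕ} (v : ZMod (3 * P) → ShortVertex Q) :
    Bool → ColoredGraph ((ZMod 3 × Bool) ⊕ ℕ) (ZMod (3 * P))
  | false => (longCycle P).map .inl
  | true => (shortCycle v).map .inl

open ModalFormula

variable {P Q r : ℕ} {v : ZMod (3 * P) → ShortVertex Q}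

theorem isLevelColoring_leaf (v : ZMod (3 * P) → ShortVertex Q) (m : ℕ) :
    IsLevelColoring levelColor (leaf P v) (mergeLevels m) where
  injective
    | 0, 0, _ => rfl
    | _ + 1, _ + 1, h => congrArg _ (Sum.inr.inj h)
  base_color_ne b _ _ := by cases b <;> exact Sum.inl_ne_inr
  map_ne {j l} := by
    rcases j with _ | j
    · simp [levelColor, mergeLevels]
    rcases l with _ | l
    · simp [levelColor, mergeLevels]
    simp only [levelColor, mergeLevels, Sum.map_inr, ne_eq, Sum.inr.injEq]
    split_ifs <;> simp only [Option.some.injEq, ZMod.natCast_eq_natCast_iff',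
      not_false_eq_true, implies_true, false_implies] <;> omega

theorem IsLevelColoring.comp_injective {E : Type} {lev : ℕ → C} {base : Bool → ColoredGraph C V}
    {ρ : C → D} (h : IsLevelColoring lev base ρ) {e : D → E} (he : Function.Injective e) :
    IsLevelColoring lev base (e ∘ ρ) :=
  ⟨h.injective, h.base_color_ne, fun hρ => he.ne (h.map_ne (he hρ))⟩

theorem covers_leaf (hPQ : P.Coprime Q) (hQ : 1 < Q) (hr : 2 * r + 6 * P < 3 * (P * Q))
    (hv : Function.Surjective v) : Covers 0 r (leaf P v false) (leaf P v true) :=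
  (covers_longCycle_shortCycle hPQ hQ hr hv).map Sum.inl

theorem exists_holds_walk_leaf_iff (hPQ : P.Coprime Q) [NeZero Q] (v : ZMod (3 * P) → ShortVertex Q)
    {ρ : (ZMod 3 × Bool) ⊕ ℕ → D} (hρ : Function.Injective (ρ ∘ .inl)) (b : Bool) :
    (∃ y, (leaf P v b).color y = levelColor 0 ∧
      (walk ((ρ ∘ .inl) ∘ cycleColor P) (3 * P * Q) 0).Holds ((leaf P v b).map ρ) y) ↔
        b = false := by
  cases b with
  | false =>
    refine iff_of_true ⟨0, ?_, (holds_walk_map hρ _ _ _ _ _).2 (holds_walk_longCycle _)⟩ rfl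
    exact congrArg Sum.inl (Prod.ext (map_zero (residue P)) (decide_eq_true rfl))
  | true =>
    refine iff_of_false ?_ (by decide)
    rintro ⟨y, hy, hwalk⟩
    exact not_holds_walk_shortCycle hPQ (Sum.inl.inj hy) ((holds_walk_map hρ _ _ _ _ _).1 hwalk)

theorem exists_surjective_shortVertex [NeZero P] [NeZero Q] (hcard : 3 * P = 3 * Q + (Q - 1)) :
    ∃ v : ZMod (3 * P) → ShortVertex Q, Function.Surjective v := by
  have hcard' : Nat.card (ZMod (3 * P)) = Nat.card (ShortVertex Q) := by
    rw [Nat.card_zmod, ShortVertex.card, hcard]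
  exact (Finite.card_eq.1 hcard').elim fun e => ⟨e, e.surjective⟩

theorem eq_levelColor_of_mergeLevels_eq {m : ℕ} {z : (ZMod 3 × Bool) ⊕ ℕ}
    (hz : mergeLevels m z = mergeLevels m (levelColor (m + 1))) : z = levelColor (m + 1) := by
  rcases z with z | j
  · cases hz
  · by_cases hj : j = m
    · rw [hj, levelColor]
    · simp [mergeLevels, levelColor, hj] at hz

theorem exists_distinguishable_forall_lt_depth (hPQ : P.Coprime Q) (hQ : 1 < Q)
    (hcard : 3 * P = 3 * Q + (Q - 1)) (hr : 2 * r + 6 * P < 3 * (P * Q)) (m : ℕ) :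
    ∃ G H : ColoredGraph (Fin (Fintype.card Palette)) (TreeVertex (ZMod (3 * P)) (m + 1)),
      Distinguishable (sigmaFO _ (m + 1) 2) G H ∧
        ∀ φ ∈ sigmaFO _ (m + 1) 2, φ.Distinguishes G H → r < φ.depth := by
  have : NeZero P := ⟨by omega⟩
  have : NeZero Q := ⟨by omega⟩
  obtain ⟨v, hv⟩ := exists_surjective_shortVertex hcard
  have e : Palette ≃ Fin (Fintype.card Palette) := Fintype.equivFin Palette
  let ρ : (ZMod 3 × Bool) ⊕ ℕ → Fin (Fintype.card Palette) := e ∘ mergeLevels m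
  let f : ℕ → Fin (Fintype.card Palette) := (ρ ∘ .inl) ∘ cycleColor P
  have hlevel : IsLevelColoring levelColor (leaf P v) ρ :=
    (isLevelColoring_leaf v m).comp_injective e.injective
  have hf (l n : ℕ) : ρ (levelColor (l + 1)) ≠ f n := e.injective.ne Sum.inr_ne_inl
  have hbase := exists_holds_walk_leaf_iff hPQ v (ρ := ρ) (e.injective.comp Sum.inl_injective)
  refine ⟨_, _, ⟨_, existsOfColor_node_mem_sigmaFO (alternations_walk f _ _) _ _ m,
    existsOfColor_node_distinguishes hlevel hf hbase
      fun z hz => eq_levelColor_of_mergeLevels_eq (e.injective hz)⟩, fun φ hφ hdist => ?_⟩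
  exact ((duplicatorWins_tree (covers_leaf hPQ hQ hr hv) m).map ρ).lt_depth hφ hdist

end Construction

theorem exists_fin_minDepth_eq [Finite V] {k r : ℕ} {L : Set (Formula C k)} {G H : ColoredGraph C V}
    (hdist : Distinguishable L G H) (hdepth : ∀ φ ∈ L, φ.Distinguishes G H → r < φ.depth) :
    ∃ G' H' : ColoredGraph C (Fin (Nat.card V)), Distinguishable L G' H' ∧
      ∃ d : ℕ, minDepth L G' H' = d ∧ r < d := by
  let e : Fin (Nat.card V) ≃ V := (Finite.equivFin V).symm
  have hdist' : Distinguishable L (G.comap e) (H.comap e) :=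
    hdist.imp fun φ hφ => hφ.imp_right (φ.distinguishes_comap e e G H).2
  obtain ⟨φ, hφL, hφ, hmin⟩ := hdist'.exists_depth_eq_minDepth
  exact ⟨_, _, hdist', φ.depth, hmin, hdepth φ hφL ((φ.distinguishes_comap e e G H).1 hφ)⟩

theorem sub_lt_of_two_mul_add_one_eq {i n t r d : ℕ} (ht : 2 ≤ t)
    (hn : 2 * n + 1 = 3 ^ i * (24 * t + 7)) (hr : r + (2 * t + 2) = 18 * t ^ 2) (hd : r < d) :
    1 / (11 * 9 ^ i) * (n : ℝ) ^ 2 - 1 / (11 * 3 ^ i) * (n : ℝ) < d := by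
  set x : ℝ := n / 3 ^ i with hx
  have h3 : (0 : ℝ) < 3 ^ i := by positivity
  have hn' : (2 * n + 1 : ℝ) = 3 ^ i * (24 * t + 7) := by exact_mod_cast hn
  have hr' : (r + (2 * t + 2) : ℝ) = 18 * t ^ 2 := by exact_mod_cast hr
  have hd' : (r + 1 : ℝ) ≤ d := by exact_mod_cast hd
  have ht' : (2 : ℝ) ≤ t := by exact_mod_cast ht
  have hx0 : 0 ≤ x := by positivity
  have hx1 : 2 * x ≤ 24 * t + 7 := by
    rw [hx, ← mul_div_assoc, div_le_iff₀ h3]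
    linarith
  calc 1 / (11 * 9 ^ i) * (n : ℝ) ^ 2 - 1 / (11 * 3 ^ i) * (n : ℝ) = (x * (x - 1)) / 11 := by
        rw [hx, show (9 : ℝ) ^ i = 3 ^ i * 3 ^ i by rw [← mul_pow]; norm_num]
        field_simp
    _ < r + 1 := by nlinarith
    _ ≤ d := hd'

end ColoredFO

theorem theorem6 :
    ∃ c : ℕ, ∀ i : ℕ, 1 ≤ i → ∀ N : ℕ, ∃ n : ℕ, N < n ∧
      ∃ G H : ColoredFO.ColoredGraph (Fin c) (Fin n),
        ColoredFO.Distinguishable (ColoredFO.sigmaFO (Fin c) i 2) G H ∧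
        ∃ d : ℕ, ColoredFO.minDepth (ColoredFO.sigmaFO (Fin c) i 2) G H = (d : ℕ∞) ∧
          (d : ℝ) > 1 / (11 * 9 ^ i) * (n : ℝ) ^ 2 - 1 / (11 * 3 ^ i) * (n : ℝ) := by
  refine ⟨Fintype.card ColoredFO.Palette, fun i hi N => ?_⟩
  obtain ⟨m, rfl⟩ := Nat.exists_eq_add_of_le' hi
  obtain ⟨t, ht, hNt⟩ : ∃ t, 2 ≤ t ∧ N ≤ t := ⟨N + 2, by omega, by omega⟩
  obtain ⟨r, hr⟩ : ∃ r, r + (2 * t + 2) = 18 * t ^ 2 :=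
    ⟨18 * t ^ 2 - (2 * t + 2), Nat.sub_add_cancel (by nlinarith)⟩
  have hcoprime : (4 * t + 1).Coprime (3 * t + 1) :=
    Nat.isCoprime_iff_coprime.1 ⟨-3, 4, by push_cast; ring⟩
  obtain ⟨G, H, hdist, hdepth⟩ := ColoredFO.exists_distinguishable_forall_lt_depth (r := r)
    hcoprime (by omega) (by omega) (by nlinarith) m
  have hcard : 2 * Nat.card (ColoredFO.TreeVertex (ZMod (3 * (4 * t + 1))) (m + 1)) + 1 =
      3 ^ (m + 1) * (24 * t + 7) := by
    rw [ColoredFO.TreeVertex.two_mul_card_add_one, Nat.card_zmod]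
    ring
  obtain ⟨G', H', hdist', d, hd, hrd⟩ := ColoredFO.exists_fin_minDepth_eq hdist hdepth
  refine ⟨_, ?_, G', H', hdist', d, hd, ColoredFO.sub_lt_of_two_mul_add_one_eq ht hcard hr hrd⟩
  nlinarith [Nat.one_le_pow (m + 1) 3 three_pos]
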